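/- Let $H$ be a complex Hilbert space with an orthonormal basis $\{|n\rangle\}_{n\in\mathbb N}$ (the Fock basis). An operator $X$ on $H$ is trace-class if $\|X\|_1=\mathrm{Tr}\sqrt{X^\dagger X}<\infty$. A quantum operation is a linear completely positive map $\Phi$ on the trace-class operators that is continuous in the trace norm; its Hilbert–Schmidt dual $\Phi^\dagger$ is the linear map on bounded operators, continuous in the operator norm, defined by $\mathrm{Tr}[Y\,\Phi(X)]=\mathrm{Tr}[\Phi^\dagger(Y)\,X]$ for all trace-class $X$ and all bounded $Y$. For a positive (i.e. positive semidefinite) trace-class operator $X=\sum_{k\ge0}x_k|\psi_k\rangle\langle\psi_k|$ with $(\psi_k)$ orthonormal and eigenvalues $x_0\ge x_1\ge\dots\ge0$, its Fock rearrangement is $X^\downarrow=\sum_{n\ge0}x_n|n\rangle\langle n|$, and $X$ is called passive if $X=X^\downarrow$. For positive trace-class $X,Y$ with decreasingly ordered eigenvalues $(x_n)$, $(y_n)$ write $X\prec_w Y$ if $\sum_{i=0}^n x_i\le\sum_{i=0}^n y_i$ for every $n\in\mathbb N$. A quantum operation $\Phi$ is passive-preserving if $\Phi(X)$ is passive for every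 passive positive trace-class $X$, and Fock-optimal if $\Phi(X)\prec_w\Phi(X^\downarrow)$ for every positive trace-class $X$. **Theorem.** Let $\Phi_1$ and $\Phi_2$ be passive-preserving and Fock-optimal quantum operations, and suppose that the restriction of $\Phi_2^\dagger$ to trace-class operators is continuous in the trace norm. Then the composition $\Phi_2\circ\Phi_1$ is a quantum operation that is also passive-preserving and Fock-optimal. -/

import Mathlib

open scoped ENNReal ComplexOrder

namespace FockOptimality

noncomputable section

/-- The trace norm `‖X‖₁ = Tr √(X† X)`, with values in `[0, ∞]`. The trace of the positive operator
`√(X† X)` is computed in the orthonormal basis `b`. -/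
def traceNorm {H : Type*} [NormedAddCommGroup H] [InnerProductSpace ℂ H] [CompleteSpace H]
    (b : HilbertBasis ℕ ℂ H) (X : H →L[ℂ] H) : ℝ≥0∞ :=
  ∑' n, ENNReal.ofReal (inner ℂ (b n) (CFC.sqrt (star X * X) (b n))).re

/-- The trace of a (trace-class) operator. -/
def trace {H : Type*} [NormedAddCommGroup H] [InnerProductSpace ℂ H]
    (b : HilbertBasis ℕ ℂ H) (X : H →L[ℂ] H) : ℂ :=
  ∑' n, inner ℂ (b n) (X (b n))

section Lemmas

variable {H : Type*} [NormedAddCommGroup H] [InnerProductSpace ℂ H] [CompleteSpace H]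

theorem norm_abs_apply (A : H →L[ℂ] H) (u : H) : ‖CFC.abs A u‖ = ‖A u‖ := by
  have h1 : (CFC.abs A) * (CFC.abs A) = star A * A := CFC.abs_mul_abs A
  have hsa : star (CFC.abs A) = CFC.abs A := (CFC.abs_nonneg A).isSelfAdjoint
  have key : ∀ T : H →L[ℂ] H, ‖T u‖ ^ 2 = (inner ℂ u ((star T * T) u)).re := by
    intro T
    rw [mul_apply_eq_comp, ContinuousLinearMap.star_eq_adjoint,
      ContinuousLinearMap.adjoint_inner_right]
    exact (inner_self_eq_norm_sq (𝕜 := ℂ) (T u)).symm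
  have h2 : ‖CFC.abs A u‖ ^ 2 = ‖A u‖ ^ 2 := by
    rw [key, key, hsa, h1]
  exact (sq_eq_sq₀ (norm_nonneg _) (norm_nonneg _)).1 h2

theorem exists_approx_polar (A : H →L[ℂ] H) {ε : ℝ} (hε : 0 < ε) :
    ∃ W K : H →L[ℂ] H, ‖W‖ ≤ 1 ∧ ‖K‖ ≤ 1 ∧
      A = W * CFC.abs A + (ε : ℂ) • W ∧ CFC.abs A = star W * A + (ε : ℂ) • K := by
  set P := CFC.abs A with hP
  have hP0 : 0 ≤ P := CFC.abs_nonneg A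
  have hPpos : P.IsPositive := (ContinuousLinearMap.nonneg_iff_isPositive P).1 hP0
  have hsa : star P = P := hP0.isSelfAdjoint
  set Q : H →L[ℂ] H := P + (ε : ℂ) • 1 with hQ
  have hQsa : star Q = Q := by
    simp [hQ, hsa]
  have hlow : ∀ u, ‖P u‖ ^ 2 + ε ^ 2 * ‖u‖ ^ 2 ≤ ‖Q u‖ ^ 2 := by
    intro u
    have e : Q u = P u + (ε : ℂ) • u := by simp [hQ]
    have h1 := norm_add_sq (𝕜 := ℂ) (P u) ((ε : ℂ) • u)
    have h2 : 0 ≤ RCLike.re (inner ℂ (P u) u) := hPpos.re_inner_nonneg_left u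
    rw [e, h1, inner_smul_right, norm_smul]
    have h3 : RCLike.re ((ε : ℂ) * inner ℂ (P u) u) = ε * RCLike.re (inner ℂ (P u) u) := by
      simp
    rw [h3]
    have h4 : ‖(ε : ℂ)‖ = ε := by simp [abs_of_pos hε]
    rw [h4]
    nlinarith [mul_nonneg hε.le h2]
  have hunit : IsUnit Q := by
    have hc : IsStrictlyPositive Q := by
      have h1 : IsStrictlyPositive ((ε : ℂ) • (1 : H →L[ℂ] H)) :=
        IsStrictlyPositive.smul (by exact_mod_cast hε) isStrictlyPositive_one
      exact h1.nonneg_add hP0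
    exact hc.isUnit
  obtain ⟨U, hU⟩ := hunit
  set R : H →L[ℂ] H := (↑U⁻¹ : H →L[ℂ] H) with hR
  have hQR : Q * R = 1 := by rw [← hU]; exact U.mul_inv
  have hRQ : R * Q = 1 := by rw [← hU]; exact U.inv_mul
  have hRsa : star R = R := by
    have : star R * Q = 1 := by
      have := congrArg star hQR
      simpa [hQsa] using this
    calc star R = star R * (Q * R) := by rw [hQR, mul_one]
      _ = R := by rw [← mul_assoc, this, one_mul]
  have hPQ : P * Q = Q * P := by simp [hQ, mul_add, add_mul]
  have hcomm : R * P = P * R := by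
    calc R * P = R * (P * Q) * R := by rw [mul_assoc, mul_assoc, hQR, mul_one]
      _ = P * R := by rw [hPQ, ← mul_assoc, hRQ, one_mul]
  have hQRv : ∀ v, Q (R v) = v := fun v => by
    rw [← mul_apply_eq_comp, hQR, one_apply_eq_self]
  have hPR : ∀ v, ‖P (R v)‖ ≤ ‖v‖ := by
    intro v
    have h := hlow (R v)
    rw [hQRv] at h
    nlinarith [norm_nonneg v, norm_nonneg (P (R v)), sq_nonneg (ε * ‖R v‖)]
  refine ⟨A * R, P * R, ?_, ?_, ?_, ?_⟩
  · refine ContinuousLinearMap.opNorm_le_bound _ zero_le_one fun v => ?_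
    rw [one_mul, mul_apply_eq_comp, ← norm_abs_apply]
    exact hPR v
  · refine ContinuousLinearMap.opNorm_le_bound _ zero_le_one fun v => ?_
    rw [one_mul, mul_apply_eq_comp]
    exact hPR v
  · calc A = A * (R * Q) := by rw [hRQ, mul_one]
      _ = _ := by rw [hQ, mul_add, mul_add]; simp [mul_assoc]
  · have h1 : star (A * R) * A = R * (P * P) := by
      rw [star_mul, hRsa, mul_assoc, hP, CFC.abs_mul_abs]
    rw [h1]
    calc P = R * Q * P := by rw [hRQ, one_mul]
      _ = _ := by rw [mul_assoc, ← hPQ, hQ, mul_add, mul_add, ← hcomm]; simp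

theorem ofReal_norm_sq_eq_tsum (b : HilbertBasis ℕ ℂ H) (v : H) :
    ENNReal.ofReal (‖v‖ ^ 2) = ∑' m, ENNReal.ofReal (‖inner ℂ (b m) v‖ ^ 2) := by
  have h := b.hasSum_inner_mul_inner v v
  have h' : HasSum (fun m => ‖inner ℂ (b m) v‖ ^ 2) (‖v‖ ^ 2) := by
    have h2 := Complex.hasSum_re h
    convert h2 using 1
    · funext m
      rw [← inner_conj_symm v (b m), ← Complex.normSq_eq_conj_mul_self, Complex.normSq_eq_norm_sq,
        Complex.ofReal_re]
    · exact (inner_self_eq_norm_sq (𝕜 := ℂ) v).symm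
  rw [← h'.tsum_eq, ENNReal.ofReal_tsum_of_nonneg (fun _ => sq_nonneg _) h'.summable]

theorem tsum_enorm_sq_adjoint (b : HilbertBasis ℕ ℂ H) (T : H →L[ℂ] H) :
    ∑' n, ENNReal.ofReal (‖star T (b n)‖ ^ 2) = ∑' n, ENNReal.ofReal (‖T (b n)‖ ^ 2) := by
  simp_rw [ofReal_norm_sq_eq_tsum b (star T _), ofReal_norm_sq_eq_tsum b (T _)]
  rw [ENNReal.tsum_comm]
  congr 1; funext n; congr 1; funext m
  rw [ContinuousLinearMap.star_eq_adjoint, ContinuousLinearMap.adjoint_inner_right,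
    ← inner_conj_symm, RCLike.norm_conj]

theorem sum_norm_le_traceNorm (b : HilbertBasis ℕ ℂ H) (X C : H →L[ℂ] H) (hC : ‖C‖ ≤ 1) (N : ℕ) :
    ENNReal.ofReal (∑ n ∈ Finset.range N, ‖inner ℂ (b n) (C (X (b n)))‖) ≤ traceNorm b X := by
  set P := CFC.abs X with hP
  have hP0 : 0 ≤ P := CFC.abs_nonneg X
  set S := CFC.sqrt P with hS
  have hSS : S * S = P := CFC.sqrt_mul_sqrt_self P hP0
  have hSsa : star S = S := (CFC.sqrt_nonneg P).isSelfAdjoint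
  have hSn : ∀ v, ‖S v‖ ^ 2 = (inner ℂ v (P v)).re := by
    intro v
    rw [← hSS, mul_apply_eq_comp]
    nth_rewrite 2 [← hSsa]
    rw [ContinuousLinearMap.star_eq_adjoint, ContinuousLinearMap.adjoint_inner_right]
    exact (inner_self_eq_norm_sq (𝕜 := ℂ) (S v)).symm
  have hT : traceNorm b X = ∑' n, ENNReal.ofReal (‖S (b n)‖ ^ 2) := by
    unfold traceNorm
    simp_rw [hSn]
    rfl
  refine ENNReal.le_of_forall_pos_le_add fun δ hδ _ => ?_
  have hε : (0 : ℝ) < δ / (N + 1) := by positivity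
  obtain ⟨W, K, hW, -, hXW, -⟩ := exists_approx_polar X hε
  set ε : ℝ := δ / (N + 1) with hεdef
  set D := C * W with hD
  have hDn : ‖D‖ ≤ 1 := (norm_mul_le _ _).trans (mul_le_one₀ hC (norm_nonneg _) hW)
  have hterm : ∀ n, ‖inner ℂ (b n) (C (X (b n)))‖ ≤
      (‖S (star D (b n))‖ ^ 2 + ‖S (b n)‖ ^ 2) / 2 + ε := by
    intro n
    have e1 : C (X (b n)) = D (S (S (b n))) + (ε : ℂ) • D (b n) := by
      rw [← mul_apply_eq_comp S S, hSS]
      conv_lhs => rw [hXW]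
      simp [hD, hP]
    have e2 : inner ℂ (b n) (D (S (S (b n)))) = inner ℂ (S (star D (b n))) (S (b n)) := by
      rw [← ContinuousLinearMap.adjoint_inner_left, ← ContinuousLinearMap.adjoint_inner_left,
        ← ContinuousLinearMap.star_eq_adjoint, ← ContinuousLinearMap.star_eq_adjoint, hSsa]
    have hb : ‖b n‖ = 1 := b.orthonormal.1 n
    rw [e1, inner_add_right, e2, inner_smul_right]
    refine (norm_add_le _ _).trans (add_le_add ?_ ?_)
    · refine (norm_inner_le_norm _ _).trans ?_
      nlinarith [sq_nonneg (‖S (star D (b n))‖ - ‖S (b n)‖)]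
    · rw [norm_mul]
      have h1 : ‖(ε : ℂ)‖ = ε := by simp [abs_of_pos hε]
      have h2 : ‖inner ℂ (b n) (D (b n))‖ ≤ 1 := by
        refine (norm_inner_le_norm _ _).trans ?_
        rw [hb, one_mul]
        exact (D.le_opNorm _).trans (by rw [hb, mul_one]; exact hDn)
      rw [h1]
      nlinarith
  have hsum : ∑ n ∈ Finset.range N, ‖inner ℂ (b n) (C (X (b n)))‖ ≤
      (∑ n ∈ Finset.range N, ‖S (star D (b n))‖ ^ 2 +
        ∑ n ∈ Finset.range N, ‖S (b n)‖ ^ 2) / 2 + δ := by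
    refine (Finset.sum_le_sum fun n _ => hterm n).trans ?_
    rw [Finset.sum_add_distrib, ← Finset.sum_div, Finset.sum_add_distrib, Finset.sum_const,
      Finset.card_range, nsmul_eq_mul]
    have : (N : ℝ) * ε ≤ δ := by
      rw [hεdef, mul_div_assoc', div_le_iff₀ (by positivity)]
      nlinarith [δ.coe_nonneg]
    linarith
  have hadj : ∑' n, ENNReal.ofReal (‖S (star D (b n))‖ ^ 2) ≤ traceNorm b X := by
    have e := tsum_enorm_sq_adjoint b (D * S)
    rw [star_mul, hSsa] at e
    have e' : ∑' n, ENNReal.ofReal (‖S (star D (b n))‖ ^ 2)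
        = ∑' n, ENNReal.ofReal (‖D (S (b n))‖ ^ 2) := e
    rw [e', hT]
    refine ENNReal.tsum_le_tsum fun n => ENNReal.ofReal_le_ofReal ?_
    have : ‖D (S (b n))‖ ≤ ‖S (b n)‖ :=
      (D.le_opNorm _).trans (mul_le_of_le_one_left (norm_nonneg _) hDn)
    gcongr
  have part : ∀ f : ℕ → ℝ, (∀ n, 0 ≤ f n) →
      ENNReal.ofReal (∑ n ∈ Finset.range N, f n) ≤ ∑' n, ENNReal.ofReal (f n) := by
    intro f hf
    rw [ENNReal.ofReal_sum_of_nonneg fun n _ => hf n]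
    exact ENNReal.sum_le_tsum _
  have p1 := (part (fun n => ‖S (star D (b n))‖ ^ 2) (fun _ => sq_nonneg _)).trans hadj
  have p2 := (part (fun n => ‖S (b n)‖ ^ 2) (fun _ => sq_nonneg _)).trans hT.ge
  refine (ENNReal.ofReal_le_ofReal hsum).trans ?_
  refine ENNReal.ofReal_add_le.trans (add_le_add ?_ (by simp))
  by_cases htop : traceNorm b X = ∞
  · rw [htop]; exact le_top
  · rw [ENNReal.ofReal_le_iff_le_toReal htop] at p1 p2 ⊢
    linarith

theorem traceNorm_add_le (b : HilbertBasis ℕ ℂ H) (X Y : H →L[ℂ] H) :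
    traceNorm b (X + Y) ≤ traceNorm b X + traceNorm b Y := by
  set A := X + Y with hA
  have hP : 0 ≤ CFC.abs A := CFC.abs_nonneg A
  have hpos : (CFC.abs A).IsPositive := (ContinuousLinearMap.nonneg_iff_isPositive _).1 hP
  rw [traceNorm, ENNReal.tsum_eq_iSup_nat]
  refine iSup_le fun N => ?_
  change ∑ n ∈ Finset.range N, ENNReal.ofReal (inner ℂ (b n) (CFC.abs A (b n))).re ≤ _
  rw [← ENNReal.ofReal_sum_of_nonneg fun n _ => show 0 ≤ (inner ℂ (b n) (CFC.abs A (b n))).re from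
    hpos.re_inner_nonneg_right (b n)]
  refine ENNReal.le_of_forall_pos_le_add fun δ hδ _ => ?_
  have hε : (0 : ℝ) < δ / (N + 1) := by positivity
  obtain ⟨W, K, hW, hK, -, hAW⟩ := exists_approx_polar A hε
  set ε : ℝ := δ / (N + 1) with hεdef
  have hW' : ‖star W‖ ≤ 1 := by rwa [norm_star]
  have hterm : ∀ n, (inner ℂ (b n) (CFC.abs A (b n))).re ≤
      ‖inner ℂ (b n) (star W (X (b n)))‖ + ‖inner ℂ (b n) (star W (Y (b n)))‖ + ε := by
    intro n
    have hb : ‖b n‖ = 1 := b.orthonormal.1 n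
    have e : CFC.abs A (b n) = star W (X (b n)) + star W (Y (b n)) + (ε : ℂ) • K (b n) := by
      rw [hAW]; simp [hA]
    rw [e, inner_add_right, inner_add_right, inner_smul_right]
    refine (Complex.re_le_norm _).trans ((norm_add_le _ _).trans
      (add_le_add (norm_add_le _ _) ?_))
    have h1 : ‖(ε : ℂ)‖ = ε := by simp [abs_of_pos hε]
    have h2 : ‖inner ℂ (b n) (K (b n))‖ ≤ 1 := by
      refine (norm_inner_le_norm _ _).trans ?_
      rw [hb, one_mul]
      exact (K.le_opNorm _).trans (by rw [hb, mul_one]; exact hK)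
    rw [norm_mul, h1]
    nlinarith
  have hsum : ∑ n ∈ Finset.range N, (inner ℂ (b n) (CFC.abs A (b n))).re ≤
      ∑ n ∈ Finset.range N, ‖inner ℂ (b n) (star W (X (b n)))‖ +
        ∑ n ∈ Finset.range N, ‖inner ℂ (b n) (star W (Y (b n)))‖ + δ := by
    refine (Finset.sum_le_sum fun n _ => hterm n).trans ?_
    rw [Finset.sum_add_distrib, Finset.sum_add_distrib, Finset.sum_const,
      Finset.card_range, nsmul_eq_mul]
    have : (N : ℝ) * ε ≤ δ := by
      rw [hεdef, mul_div_assoc', div_le_iff₀ (by positivity)]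
      nlinarith [δ.coe_nonneg]
    linarith
  refine (ENNReal.ofReal_le_ofReal hsum).trans ?_
  refine ENNReal.ofReal_add_le.trans (add_le_add ?_ (by simp))
  exact ENNReal.ofReal_add_le.trans (add_le_add (sum_norm_le_traceNorm b X _ hW' N)
    (sum_norm_le_traceNorm b Y _ hW' N))

theorem traceNorm_smul (b : HilbertBasis ℕ ℂ H) (c : ℂ) (X : H →L[ℂ] H) :
    traceNorm b (c • X) = ENNReal.ofReal ‖c‖ * traceNorm b X := by
  have h : CFC.sqrt (star (c • X) * (c • X)) = ‖c‖ • CFC.sqrt (star X * X) := CFC.abs_smul c X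
  unfold traceNorm
  rw [h, ← ENNReal.tsum_mul_left]
  congr 1; funext n
  rw [← ENNReal.ofReal_mul (norm_nonneg c)]
  congr 1
  have : (‖c‖ • CFC.sqrt (star X * X)) (b n) = (‖c‖ : ℂ) • CFC.sqrt (star X * X) (b n) := by
    simp
  rw [this, inner_smul_right]
  simp

end Lemmas

/-- The space of trace-class operators. -/
def traceClass {H : Type*} [NormedAddCommGroup H] [InnerProductSpace ℂ H] [CompleteSpace H]
    (b : HilbertBasis ℕ ℂ H) : Submodule ℂ (H →L[ℂ] H) where
  carrier := {X | traceNorm b X < ∞}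
  zero_mem' := by simp [traceNorm]
  add_mem' {X Y} hX hY :=
    (traceNorm_add_le b X Y).trans_lt (ENNReal.add_lt_top.2 ⟨hX, hY⟩)
  smul_mem' c X hX := by
    change traceNorm b (c • X) < ∞
    rw [traceNorm_smul]
    exact ENNReal.mul_lt_top ENNReal.ofReal_lt_top hX

/-- `x` is the sequence of eigenvalues of the positive compact operator `X` in decreasing order,
repeated with multiplicity: `X = ∑ₖ xₖ |ψₖ⟩⟨ψₖ|` for an orthonormal sequence `ψ`, with
`x₀ ≥ x₁ ≥ … ≥ 0`. (An operator of finite rank has the eigenvalue `0` in the end; an operator with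
infinitely many positive eigenvalues is described by these alone.) -/
def IsEigenvalueSequence {H : Type*} [NormedAddCommGroup H] [InnerProductSpace ℂ H]
    (X : H →L[ℂ] H) (x : ℕ → ℝ) : Prop :=
  Antitone x ∧ (∀ n, 0 ≤ x n) ∧ ∃ ψ : ℕ → H, Orthonormal ℂ ψ ∧
    HasSum (fun k => (x k : ℂ) • InnerProductSpace.rankOne ℂ (ψ k) (ψ k)) X

open Classical in
/-- The sequence of eigenvalues of a positive trace-class operator in decreasing order (by the
spectral theorem and the min-max principle it exists and is unique). -/
def eigenvalues {H : Type*} [NormedAddCommGroup H] [InnerProductSpace ℂ H]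
    (X : H →L[ℂ] H) : ℕ → ℝ :=
  if h : ∃ x, IsEigenvalueSequence X x then h.choose else 0

/-- The operator `∑ₙ xₙ |n⟩⟨n|`, diagonal in the basis `b`. -/
def diagonal {H : Type*} [NormedAddCommGroup H] [InnerProductSpace ℂ H]
    (b : HilbertBasis ℕ ℂ H) (x : ℕ → ℝ) : H →L[ℂ] H :=
  ∑' n, (x n : ℂ) • InnerProductSpace.rankOne ℂ (b n) (b n)

section Lemmas

variable {H : Type*} [NormedAddCommGroup H] [InnerProductSpace ℂ H] [CompleteSpace H]

/-- For a nonnegative combination of rank-one projectors the trace norm is the sum of the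
coefficients. -/
theorem traceNorm_of_hasSum (b : HilbertBasis ℕ ℂ H) {X : H →L[ℂ] H} {x : ℕ → ℝ} {ψ : ℕ → H}
    (hx : ∀ n, 0 ≤ x n) (hψ : ∀ n, ‖ψ n‖ = 1)
    (h : HasSum (fun k => (x k : ℂ) • InnerProductSpace.rankOne ℂ (ψ k) (ψ k)) X) :
    traceNorm b X = ∑' n, ENNReal.ofReal (x n) := by
  have hq : ∀ v : H, HasSum (fun k => x k * ‖inner ℂ v (ψ k)‖ ^ 2) (inner ℂ v (X v)).re := by
    intro v
    have h1 := h.mapL (ContinuousLinearMap.apply ℂ H v)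
    have h2 := Complex.hasSum_re (h1.mapL (innerSL ℂ v))
    change HasSum _ (inner ℂ v (X v)).re at h2
    convert h2 using 1
    funext k
    simp only [ContinuousLinearMap.apply_apply, innerSL_apply_apply, smul_apply,
      InnerProductSpace.rankOne_apply, inner_smul_right]
    rw [← inner_conj_symm (ψ k) v, ← Complex.normSq_eq_conj_mul_self, ← Complex.ofReal_mul,
      Complex.ofReal_re, Complex.normSq_eq_norm_sq]
  have hpos : 0 ≤ X := by
    refine h.nonneg fun k => ?_
    have hk : 0 ≤ InnerProductSpace.rankOne ℂ (ψ k) (ψ k) :=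
      (ContinuousLinearMap.nonneg_iff_isPositive _).2
        (InnerProductSpace.isPositive_rankOne_self (ψ k))
    exact smul_nonneg (by exact_mod_cast hx k) hk
  have habs : CFC.sqrt (star X * X) = X := CFC.abs_of_nonneg X hpos
  have hnn : ∀ v : H, ∀ k, 0 ≤ x k * ‖inner ℂ v (ψ k)‖ ^ 2 := fun v k =>
    mul_nonneg (hx k) (sq_nonneg _)
  unfold traceNorm
  rw [habs]
  simp_rw [← (hq _).tsum_eq]
  simp_rw [fun n => ENNReal.ofReal_tsum_of_nonneg (hnn (b n)) (hq (b n)).summable]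
  rw [ENNReal.tsum_comm]
  congr 1; funext k
  simp_rw [fun n => ENNReal.ofReal_mul (q := ‖inner ℂ (b n) (ψ k)‖ ^ 2) (hx k)]
  rw [ENNReal.tsum_mul_left, ← ofReal_norm_sq_eq_tsum, hψ]
  simp

theorem tsum_eigenvalues_lt_top (b : HilbertBasis ℕ ℂ H) (X : traceClass b) :
    ∑' n, ENNReal.ofReal (eigenvalues (X : H →L[ℂ] H) n) < ∞ := by
  by_cases h : ∃ x, IsEigenvalueSequence (X : H →L[ℂ] H) x
  · have e : eigenvalues (X : H →L[ℂ] H) = h.choose := by simp only [eigenvalues, dif_pos h]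
    rw [e]
    obtain ⟨-, hx, ψ, hψ, hs⟩ := h.choose_spec
    rw [← traceNorm_of_hasSum b hx hψ.1 hs]
    exact X.2
  · have e : eigenvalues (X : H →L[ℂ] H) = 0 := by simp only [eigenvalues, dif_neg h]
    simp [e]

theorem eigenvalues_nonneg {H : Type*} [NormedAddCommGroup H] [InnerProductSpace ℂ H]
    (X : H →L[ℂ] H) (n : ℕ) : 0 ≤ eigenvalues X n := by
  by_cases h : ∃ x, IsEigenvalueSequence X x
  · rw [show eigenvalues X = h.choose by simp only [eigenvalues, dif_pos h]]
    exact h.choose_spec.2.1 n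
  · simp [eigenvalues, dif_neg h]

theorem diagonal_mem (b : HilbertBasis ℕ ℂ H) {x : ℕ → ℝ} (hx : ∀ n, 0 ≤ x n)
    (hs : ∑' n, ENNReal.ofReal (x n) < ∞) : diagonal b x ∈ traceClass b := by
  have hsum : Summable x := by
    have := ENNReal.summable_toReal hs.ne
    simpa [ENNReal.toReal_ofReal (hx _)] using this
  have hS : Summable fun n => (x n : ℂ) • InnerProductSpace.rankOne ℂ (b n) (b n) := by
    refine Summable.of_norm_bounded hsum fun n => ?_
    rw [norm_smul, InnerProductSpace.norm_rankOne, b.orthonormal.1 n]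
    simp [abs_of_nonneg (hx n)]
  change traceNorm b (diagonal b x) < ∞
  exact (traceNorm_of_hasSum b hx b.orthonormal.1 hS.hasSum).trans_lt hs

end Lemmas

section Definitions

variable {H : Type*} [NormedAddCommGroup H] [InnerProductSpace ℂ H] [CompleteSpace H]
  (b : HilbertBasis ℕ ℂ H)

/-- Continuity in the trace norm of a map defined on the trace-class operators. (The trace norm of
the differences on the right is finite as a part of the requirement: a linear map that is continuous
in this sense maps trace-class operators to trace-class operators.) -/
def TraceNormContinuous (F : traceClass b → (H →L[ℂ] H)) : Prop :=
  ∀ X : traceClass b, ∀ ε : ℝ≥0∞, 0 < ε → ∃ δ : ℝ≥0∞, 0 < δ ∧ ∀ Y : traceClass b,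
    traceNorm b ((Y : H →L[ℂ] H) - X) < δ → traceNorm b (F Y - F X) < ε

/-- Complete positivity: `Φ ⊗ id` maps positive operators on `H ⊗ ℂⁿ` to positive operators, for
every `n`. An operator on `H ⊗ ℂⁿ` is an `n × n` matrix of operators on `H`. -/
def CompletelyPositive (Φ : traceClass b →ₗ[ℂ] traceClass b) : Prop :=
  ∀ (n : ℕ) (X : Fin n → Fin n → traceClass b),
    (∀ v : Fin n → H, 0 ≤ ∑ i, ∑ j, inner ℂ (v i) ((X i j : H →L[ℂ] H) (v j))) →
    ∀ v : Fin n → H, 0 ≤ ∑ i, ∑ j, inner ℂ (v i) ((Φ (X i j) : H →L[ℂ] H) (v j))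

/-- A quantum operation is a linear completely positive map on trace-class operators which is
continuous in the trace norm. -/
structure IsQuantumOperation (Φ : traceClass b →ₗ[ℂ] traceClass b) : Prop where
  completelyPositive : CompletelyPositive b Φ
  traceNormContinuous : TraceNormContinuous b fun X => (Φ X : H →L[ℂ] H)

/-- The defining property of the Hilbert–Schmidt dual, a map on bounded operators which is
continuous in the operator norm: `Tr [Y Φ(X)] = Tr [Φ†(Y) X]` for all trace-class `X` and all
bounded `Y`. -/
def IsHilbertSchmidtDual (Φ : traceClass b →ₗ[ℂ] traceClass b)
    (Ψ : (H →L[ℂ] H) →L[ℂ] (H →L[ℂ] H)) : Prop :=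
  ∀ (X : traceClass b) (Y : H →L[ℂ] H),
    trace b (Y * (Φ X : H →L[ℂ] H)) = trace b (Ψ Y * (X : H →L[ℂ] H))

open Classical in
/-- The Hilbert–Schmidt dual `Φ†` (it exists and is unique for `Φ` continuous in the trace norm). -/
def hilbertSchmidtDual (Φ : traceClass b →ₗ[ℂ] traceClass b) :
    (H →L[ℂ] H) →L[ℂ] (H →L[ℂ] H) :=
  if h : ∃ Ψ, IsHilbertSchmidtDual b Φ Ψ then h.choose else 0

/-- The Fock rearrangement `X↓ = ∑ₙ xₙ |n⟩⟨n|` of a positive trace-class operator with eigenvalues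
`x₀ ≥ x₁ ≥ …`. -/
def fockRearrangement (X : traceClass b) : traceClass b :=
  ⟨diagonal b (eigenvalues (X : H →L[ℂ] H)),
    diagonal_mem b (eigenvalues_nonneg _) (tsum_eigenvalues_lt_top b X)⟩

/-- An operator is passive if it coincides with its Fock rearrangement. -/
def IsPassive (X : traceClass b) : Prop :=
  X = fockRearrangement b X

/-- `X` is weakly sub-majorized by `Y`, for positive trace-class operators: `X ≺_w Y`. -/
def WeaklySubmajorizedBy (X Y : traceClass b) : Prop :=
  ∀ n : ℕ, ∑ i ∈ Finset.range (n + 1), eigenvalues (X : H →L[ℂ] H) i ≤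
    ∑ i ∈ Finset.range (n + 1), eigenvalues (Y : H →L[ℂ] H) i

/-- `Φ` maps passive positive trace-class operators to passive operators. -/
def PassivePreserving (Φ : traceClass b →ₗ[ℂ] traceClass b) : Prop :=
  ∀ X : traceClass b, (X : H →L[ℂ] H).IsPositive → IsPassive b X → IsPassive b (Φ X)

/-- `Φ(X) ≺_w Φ(X↓)` for all positive trace-class operators `X`. -/
def FockOptimal (Φ : traceClass b →ₗ[ℂ] traceClass b) : Prop :=
  ∀ X : traceClass b, (X : H →L[ℂ] H).IsPositive →
    WeaklySubmajorizedBy b (Φ X) (Φ (fockRearrangement b X))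

end Definitions

end

end FockOptimality

open FockOptimality

/-! Fock-optimality of `Φ₂` bounds `Φ₂(Φ₁(X))` by `Φ₂(Φ₁(X)↓)`, and that of `Φ₁` gives `Φ₁(X) ≺_w
Φ₁(X↓)`, where `Φ₁(X↓)` is passive and so its own rearrangement. What remains is that `Z ↦ Φ₂(Z↓)`
is monotone for `≺_w`: `WeaklySubmajorizedBy.map_fockRearrangement`.

Let `P` project onto the first `n + 1` Fock states. As `Φ₂(Z↓)` is passive, its first `n + 1`
eigenvalues sum to `Tr[P Φ₂(Z↓)] = ∑ₖ zₖ cₖ` with `cₖ = Tr[P Φ₂(|k⟩⟨k|)] ≥ 0`, by trace-norm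
continuity. If `c` is decreasing, summation by parts yields the monotonicity.

To see `cⱼ₊₁ ≤ cⱼ`, replace `|j⟩⟨j|` by `|j+1⟩⟨j+1|` in `∑_{i≤j} |i⟩⟨i|`; the Fock rearrangement
undoes the replacement. Ky Fan's inequality, Fock-optimality and passivity compare the two values of
`Tr[P Φ₂(·)]`, and the common terms cancel (`antitone_diagonalSum_fockProjector`).

Ky Fan's inequality also makes eigenvalue sequences unique; their existence is the spectral theorem,
proved by deflation. -/

namespace FockOptimality

/-! ### Spectral theorem for positive trace-class operators -/

section Spectral

open InnerProductSpace Filter Topology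

variable {H : Type*} [NormedAddCommGroup H] [InnerProductSpace ℂ H]

theorem re_inner_smul_rankOne (c : ℝ) (u v : H) :
    (inner ℂ v (((c : ℂ) • rankOne ℂ u u) v)).re = c * ‖inner ℂ v u‖ ^ 2 := by
  simp only [smul_apply, rankOne_apply, inner_smul_right]
  rw [← inner_conj_symm u v, ← Complex.normSq_eq_conj_mul_self, ← Complex.ofReal_mul,
    Complex.ofReal_re, Complex.normSq_eq_norm_sq]

/-- The quadratic form of a combination of rank-one projectors. -/
theorem hasSum_re_inner_of_hasSum_rankOne {X : H →L[ℂ] H} {x : ℕ → ℝ} {ψ : ℕ → H}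
    (h : HasSum (fun k => (x k : ℂ) • rankOne ℂ (ψ k) (ψ k)) X) (v : H) :
    HasSum (fun k => x k * ‖inner ℂ v (ψ k)‖ ^ 2) (inner ℂ v (X v)).re := by
  have h1 := h.mapL (ContinuousLinearMap.apply ℂ H v)
  have h2 := Complex.hasSum_re (h1.mapL (innerSL ℂ v))
  change HasSum _ (inner ℂ v (X v)).re at h2
  convert h2 using 1
  funext k
  exact (re_inner_smul_rankOne _ _ _).symm

theorem isCompactOperator_rankOne (u v : H) : IsCompactOperator (rankOne ℂ u v) :=
  (isCompactOperator_id.clm_comp (ContinuousLinearMap.toSpanSingleton ℂ u)).comp_clm (innerSL ℂ v)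

theorem rankOne_self_nonneg (u : H) : 0 ≤ rankOne ℂ u u :=
  (ContinuousLinearMap.nonneg_iff_isPositive _).2 (isPositive_rankOne_self u)

theorem isSymmetric_of_nonneg {T : H →L[ℂ] H} (hT : 0 ≤ T) (u v : H) :
    inner ℂ (T u) v = inner ℂ u (T v) :=
  ((ContinuousLinearMap.nonneg_iff_isPositive T).1 hT).isSymmetric u v

variable [CompleteSpace H]

theorem norm_sqrt_apply_sq {X : H →L[ℂ] H} (hX : 0 ≤ X) (v : H) :
    ‖CFC.sqrt X v‖ ^ 2 = (inner ℂ v (X v)).re := by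
  have hsa : star (CFC.sqrt X) = CFC.sqrt X := (CFC.sqrt_nonneg X).isSelfAdjoint
  conv_rhs => rw [← CFC.sqrt_mul_sqrt_self X hX, mul_apply_eq_comp]
  nth_rewrite 2 [← hsa]
  rw [ContinuousLinearMap.star_eq_adjoint, ContinuousLinearMap.adjoint_inner_right]
  exact (inner_self_eq_norm_sq (𝕜 := ℂ) _).symm

theorem traceNorm_of_nonneg (b : HilbertBasis ℕ ℂ H) {X : H →L[ℂ] H} (hX : 0 ≤ X) :
    traceNorm b X = ∑' n, ENNReal.ofReal (inner ℂ (b n) (X (b n))).re := by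
  have habs : CFC.sqrt (star X * X) = X := CFC.abs_of_nonneg X hX
  rw [traceNorm, habs]

/-- With `S = √X`, the operator is the sum of the rank-one operators `S|n⟩⟨n|S`. Their norms
`‖S|n⟩‖² = ⟨n|X|n⟩` add up to the trace, so `X` is a norm limit of finite-rank operators. -/
theorem isCompactOperator_of_traceNorm_lt_top (b : HilbertBasis ℕ ℂ H) {X : H →L[ℂ] H}
    (hX : 0 ≤ X) (ht : traceNorm b X < ∞) : IsCompactOperator X := by
  set S := CFC.sqrt X with hS
  have hsa : star S = S := (CFC.sqrt_nonneg X).isSelfAdjoint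
  have hsum : Summable fun n => ‖S (b n)‖ ^ 2 := by
    rw [traceNorm_of_nonneg b hX] at ht
    simp_rw [← norm_sqrt_apply_sq hX] at ht
    have := ENNReal.summable_toReal ht.ne
    simpa [ENNReal.toReal_ofReal (sq_nonneg _)] using this
  have hsm : Summable fun n => rankOne ℂ (S (b n)) (S (b n)) := by
    refine Summable.of_norm_bounded hsum fun n => ?_
    rw [norm_rankOne, sq]
  have hXs : HasSum (fun n => rankOne ℂ (S (b n)) (S (b n))) X := by
    obtain ⟨Y, hY⟩ := hsm
    convert hY
    ext v
    have h1 : HasSum (fun n => (rankOne ℂ (S (b n)) (S (b n))) v) (Y v) :=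
      hY.mapL (ContinuousLinearMap.apply ℂ H v)
    have h2 := (b.hasSum_repr (S v)).mapL S
    rw [← mul_apply_eq_comp, hS, CFC.sqrt_mul_sqrt_self X hX] at h2
    refine h2.unique ?_
    convert h1 using 2 with n
    rw [rankOne_apply, map_smul, b.repr_apply_apply]
    rw [← hS, ← ContinuousLinearMap.adjoint_inner_left, ← ContinuousLinearMap.star_eq_adjoint, hsa]
  refine isCompactOperator_of_tendsto hXs.tendsto_sum_nat (Eventually.of_forall fun n => ?_)
  exact (compactOperator (RingHom.id ℂ) H H).sum_mem fun i _ => isCompactOperator_rankOne _ _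

/-- A nonzero positive compact operator has its norm as an eigenvalue. -/
theorem exists_unit_eigenvector_norm {T : H →L[ℂ] H} (hT : 0 ≤ T) (hc : IsCompactOperator T)
    (h0 : T ≠ 0) : ∃ u : H, ‖u‖ = 1 ∧ T u = (‖T‖ : ℂ) • u := by
  have : Nontrivial (H →L[ℂ] H) := ⟨T, 0, h0⟩
  have h1 : ‖T‖ ∈ spectrum ℝ T := CStarAlgebra.norm_mem_spectrum_of_nonneg hT
  have h2 : (‖T‖ : ℂ) ∈ spectrum ℂ T := spectrum.algebraMap_mem ℂ h1
  -- A nonzero spectral value of a compact operator is an eigenvalue.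
  have h3 : (‖T‖ : ℂ) ≠ 0 := by simpa using h0
  obtain ⟨v, hv⟩ := ((hc.hasEigenvalue_iff_mem_spectrum h3).2 h2).exists_hasEigenvector
  have hv0 : ‖v‖ ≠ 0 := norm_ne_zero_iff.2 hv.2
  refine ⟨((‖v‖⁻¹ : ℝ) : ℂ) • v, ?_, ?_⟩
  · rw [norm_smul]; simp [hv0]
  · rw [map_smul, smul_comm]
    congr 1
    exact hv.apply_eq_smul

/-- A positive compact operator that vanishes on a finite-dimensional subspace has a unit vector
orthogonal to it as an eigenvector for its norm. -/
theorem exists_unit_eigenvector_norm_orthogonal (hH : ¬ FiniteDimensional ℂ H)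
    (V : Submodule ℂ H) [FiniteDimensional ℂ V]
    {T : H →L[ℂ] H} (hT : 0 ≤ T) (hc : IsCompactOperator T) (hV : ∀ v ∈ V, T v = 0) :
    ∃ u ∈ Vᗮ, ‖u‖ = 1 ∧ T u = (‖T‖ : ℂ) • u := by
  by_cases h0 : T = 0
  -- For `T = 0` any unit vector orthogonal to `V` serves; it exists because `H` is
  -- infinite-dimensional.
  · have hne : Vᗮ ≠ ⊥ := by
      intro h
      rw [Submodule.orthogonal_eq_bot_iff] at h
      subst h
      exact hH (Module.Finite.equiv (Submodule.topEquiv (R := ℂ) (M := H)))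
    obtain ⟨v, hv, hv0⟩ := Submodule.exists_mem_ne_zero_of_ne_bot hne
    refine ⟨((‖v‖⁻¹ : ℝ) : ℂ) • v, Vᗮ.smul_mem _ hv, ?_, by simp [h0]⟩
    have : ‖v‖ ≠ 0 := norm_ne_zero_iff.2 hv0
    rw [norm_smul]; simp [this]
  · obtain ⟨u, hu, hTu⟩ := exists_unit_eigenvector_norm hT hc h0
    refine ⟨u, (V.mem_orthogonal u).2 fun v hv => ?_, hu, hTu⟩
    have h1 : inner ℂ v (T u) = 0 := by
      rw [← isSymmetric_of_nonneg hT, hV v hv, inner_zero_left]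
    rw [hTu, inner_smul_right] at h1
    refine (mul_eq_zero.1 h1).resolve_left ?_
    simpa using h0

/-- Since `u` is a unit eigenvector, the difference equals the compression `(1 - |u⟩⟨u|) T (1 -
|u⟩⟨u|)` of a positive operator. -/
theorem sub_smul_rankOne_nonneg {T : H →L[ℂ] H} (hT : 0 ≤ T) {u : H} (hu : ‖u‖ = 1)
    {c : ℝ} (hTu : T u = (c : ℂ) • u) : 0 ≤ T - (c : ℂ) • rankOne ℂ u u := by
  have huu : inner ℂ u u = (1 : ℂ) := by
    rw [inner_self_eq_norm_sq_to_K, hu]; simp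
  have h1 : star (1 - rankOne ℂ u u) = 1 - rankOne ℂ u u := by
    rw [star_sub, star_one, (rankOne_self_nonneg u).isSelfAdjoint.star_eq]
  have h2 : T - (c : ℂ) • rankOne ℂ u u
      = star (1 - rankOne ℂ u u) * T * (1 - rankOne ℂ u u) := by
    rw [h1]
    ext v
    have h3 : inner ℂ u (T v) = (c : ℂ) * inner ℂ u v := by
      rw [← isSymmetric_of_nonneg hT, hTu, inner_smul_left, Complex.conj_ofReal]
    simp only [mul_apply_eq_comp, sub_apply, one_apply_eq_self, smul_apply, rankOne_apply,
      map_sub, map_smul, hTu, h3, huu, smul_sub, smul_smul]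
    module
  rw [h2]
  exact star_left_conjugate_nonneg hT _

/-- Stages of the successive splitting-off of leading eigenvectors: the span of the vectors found so
far and the remaining operator. -/
structure Deflation (H : Type*) [NormedAddCommGroup H] [InnerProductSpace ℂ H]
    [CompleteSpace H] where
  space : Submodule ℂ H
  op : H →L[ℂ] H
  finiteDimensional : FiniteDimensional ℂ space
  nonneg : 0 ≤ op
  isCompact : IsCompactOperator op
  apply_eq_zero : ∀ v ∈ space, op v = 0

theorem Deflation.exists_vec (hH : ¬ FiniteDimensional ℂ H) (D : Deflation H) :
    ∃ u ∈ D.spaceᗮ, ‖u‖ = 1 ∧ D.op u = (‖D.op‖ : ℂ) • u :=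
  haveI := D.finiteDimensional
  exists_unit_eigenvector_norm_orthogonal hH D.space D.nonneg D.isCompact D.apply_eq_zero

/-- One deflation step, stated so that `choose` can iterate it. The norm does not grow because the
new operator lies between `0` and the old one. -/
theorem Deflation.exists_next (hH : ¬ FiniteDimensional ℂ H) (D : Deflation H) :
    ∃ (u : H) (E : Deflation H), u ∈ D.spaceᗮ ∧ ‖u‖ = 1 ∧ u ∈ E.space ∧ D.space ≤ E.space ∧
      E.op = D.op - (‖D.op‖ : ℂ) • rankOne ℂ u u ∧ ‖E.op‖ ≤ ‖D.op‖ := by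
  obtain ⟨u, hu, hu1, hDu⟩ := D.exists_vec hH
  have := D.finiteDimensional
  have huu : inner ℂ u u = (1 : ℂ) := by
    rw [inner_self_eq_norm_sq_to_K, hu1]; simp
  have hnn := sub_smul_rankOne_nonneg D.nonneg hu1 hDu
  refine ⟨u, ⟨D.space ⊔ ℂ ∙ u, D.op - (‖D.op‖ : ℂ) • rankOne ℂ u u, inferInstance, hnn,
    D.isCompact.sub ((isCompactOperator_rankOne u u).smul _), fun v hv => ?_⟩, hu, hu1,
    Submodule.mem_sup_right (Submodule.mem_span_singleton_self u), le_sup_left, rfl, ?_⟩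
  · obtain ⟨w, hw, z, hz, rfl⟩ := Submodule.mem_sup.1 hv
    obtain ⟨a, rfl⟩ := Submodule.mem_span_singleton.1 hz
    have h1 : inner ℂ u w = (0 : ℂ) := (D.space.mem_orthogonal' u).1 hu w hw
    simp only [sub_apply, smul_apply, rankOne_apply, map_add, map_smul, D.apply_eq_zero w hw, hDu,
      h1, huu]
    module
  · refine CStarAlgebra.norm_le_norm_of_nonneg_of_le hnn (sub_le_self _ ?_)
    exact smul_nonneg (by exact_mod_cast norm_nonneg _) (rankOne_self_nonneg u)

/-- The spectral theorem for positive trace-class operators. -/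
theorem exists_isEigenvalueSequence (b : HilbertBasis ℕ ℂ H) {X : H →L[ℂ] H}
    (hX : 0 ≤ X) (ht : traceNorm b X < ∞) : ∃ x, IsEigenvalueSequence X x := by
  -- An orthonormal family indexed by `ℕ` forces infinite dimension, so the deflation never stops.
  have hH : ¬ FiniteDimensional ℂ H := fun _ =>
    have := b.orthonormal.linearIndependent.finite
    not_finite ℕ
  choose vec next h1 h2 h3 h4 h5 h6 using fun D : Deflation H => D.exists_next hH
  let D : ℕ → Deflation H := fun n => next^[n]
    ⟨⊥, X, inferInstance, hX, isCompactOperator_of_traceNorm_lt_top b hX ht, by simp⟩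
  have hD : ∀ n, D (n + 1) = next (D n) := fun n => Function.iterate_succ_apply' _ _ _
  set ψ : ℕ → H := fun n => vec (D n) with hψ
  set x : ℕ → ℝ := fun n => ‖(D n).op‖ with hx
  have hx0 : ∀ n, 0 ≤ x n := fun n => norm_nonneg _
  have hanti : Antitone x := antitone_nat_of_succ_le fun n => by
    simp only [hx, hD]; exact h6 _
  have hmono : Monotone fun n => (D n).space := monotone_nat_of_le_succ fun n => by
    simp only [hD]; exact h4 _
  have hlt : ∀ m n, m < n → inner ℂ (ψ n) (ψ m) = 0 := fun m n hmn =>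
    ((D n).space.mem_orthogonal' _).1 (h1 _) _
      (hmono (Nat.succ_le_of_lt hmn) (by simp only [Nat.succ_eq_add_one, hD]; exact h3 _))
  have horth : Orthonormal ℂ ψ := by
    refine ⟨fun n => h2 _, fun m n hmn => ?_⟩
    rcases lt_or_gt_of_ne hmn with h | h
    · rw [← inner_conj_symm, hlt m n h, map_zero]
    · exact hlt n m h
  have hop : ∀ N, (D N).op = X - ∑ k ∈ Finset.range N, (x k : ℂ) • rankOne ℂ (ψ k) (ψ k) := by
    intro N
    induction N with
    | zero => simp [D]
    | succ N ih => rw [hD, h5, Finset.sum_range_succ, ← sub_sub, ← ih]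
  -- The operator left after `N` steps is positive, hence has nonnegative diagonal; so the trace of
  -- the part split off is at most that of `X`.
  have hpart : ∀ N, ∑ k ∈ Finset.range N, ENNReal.ofReal (x k) ≤ traceNorm b X := by
    intro N
    rw [traceNorm_of_nonneg b hX]
    calc ∑ k ∈ Finset.range N, ENNReal.ofReal (x k)
        = ∑ k ∈ Finset.range N, ∑' n, ENNReal.ofReal (x k * ‖inner ℂ (b n) (ψ k)‖ ^ 2) := by
          refine Finset.sum_congr rfl fun k _ => ?_
          simp_rw [ENNReal.ofReal_mul (hx0 k)]
          rw [ENNReal.tsum_mul_left, ← ofReal_norm_sq_eq_tsum, horth.1]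
          simp
      _ = ∑' n, ∑ k ∈ Finset.range N, ENNReal.ofReal (x k * ‖inner ℂ (b n) (ψ k)‖ ^ 2) :=
          (Summable.tsum_finsetSum fun _ _ => ENNReal.summable).symm
      _ ≤ _ := by
          refine ENNReal.tsum_le_tsum fun n => ?_
          rw [← ENNReal.ofReal_sum_of_nonneg fun k _ => mul_nonneg (hx0 k) (sq_nonneg _)]
          refine ENNReal.ofReal_le_ofReal ?_
          have hp := ((ContinuousLinearMap.nonneg_iff_isPositive _).1
            (D N).nonneg).re_inner_nonneg_right (b n)
          rw [hop, sub_apply, inner_sub_right, map_sub, sub_nonneg, sum_apply, inner_sum,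
            map_sum] at hp
          exact (Finset.sum_congr rfl fun k _ => re_inner_smul_rankOne _ _ _).ge.trans hp
  have hsum : Summable x := by
    have hle : ∑' k, ENNReal.ofReal (x k) ≤ traceNorm b X := by
      rw [ENNReal.tsum_eq_iSup_nat]
      exact iSup_le hpart
    have := ENNReal.summable_toReal (hle.trans_lt ht).ne
    simpa [ENNReal.toReal_ofReal (hx0 _)] using this
  refine ⟨x, hanti, hx0, ψ, horth, ?_⟩
  have hsm : Summable fun k => (x k : ℂ) • rankOne ℂ (ψ k) (ψ k) := by
    refine Summable.of_norm_bounded hsum fun n => ?_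
    rw [norm_smul, norm_rankOne, horth.1 n]
    simp [abs_of_nonneg (hx0 n)]
  -- The error after `N` terms is the `N`-th remaining operator, of norm `x N`, which tends to `0`
  -- by summability.
  refine (hsm.hasSum_iff_tendsto_nat).2 ?_
  rw [tendsto_iff_norm_sub_tendsto_zero]
  refine hsum.tendsto_atTop_zero.congr fun N => ?_
  rw [norm_sub_rev, ← hop]

end Spectral

/-! ### Ky Fan's inequality, uniqueness of eigenvalues, passive operators -/

section KyFan

open InnerProductSpace

variable {H : Type*} [NormedAddCommGroup H] [InnerProductSpace ℂ H]

/-- Ky Fan's inequality: the eigenvalues dominate the diagonal in any orthonormal sequence. -/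
theorem IsEigenvalueSequence.sum_re_inner_le {X : H →L[ℂ] H} {x : ℕ → ℝ}
    (hx : IsEigenvalueSequence X x) {φ : ℕ → H} (hφ : Orthonormal ℂ φ) (n : ℕ) :
    ∑ i ∈ Finset.range n, (inner ℂ (φ i) (X (φ i))).re ≤ ∑ i ∈ Finset.range n, x i := by
  obtain ⟨hanti, h0, ψ, hψ, hs⟩ := hx
  -- The diagonal sum is `∑ₖ xₖ wₖ`. By Bessel's inequality, used once for each orthonormal
  -- sequence, `0 ≤ wₖ ≤ 1` and the total weight is at most `n`; such weights do best when placed on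
  -- the first `n` indices.
  set w : ℕ → ℝ := fun k => ∑ i ∈ Finset.range n, ‖inner ℂ (φ i) (ψ k)‖ ^ 2 with hw
  have hsum : HasSum (fun k => x k * w k)
      (∑ i ∈ Finset.range n, (inner ℂ (φ i) (X (φ i))).re) := by
    simp only [hw, Finset.mul_sum]
    exact hasSum_sum fun i _ => hasSum_re_inner_of_hasSum_rankOne hs (φ i)
  have hw0 : ∀ k, 0 ≤ w k := fun k => Finset.sum_nonneg fun _ _ => sq_nonneg _
  have hw1 : ∀ k, w k ≤ 1 := fun k => by
    have := hφ.sum_inner_products_le (ψ k) (s := Finset.range n)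
    rwa [hψ.1 k, one_pow] at this
  have hwn : ∀ s : Finset ℕ, ∑ k ∈ s, w k ≤ n := by
    intro s
    simp only [hw]
    rw [Finset.sum_comm]
    calc ∑ i ∈ Finset.range n, ∑ k ∈ s, ‖inner ℂ (φ i) (ψ k)‖ ^ 2
        ≤ ∑ i ∈ Finset.range n, (1 : ℝ) := by
          refine Finset.sum_le_sum fun i _ => ?_
          have := hψ.sum_inner_products_le (φ i) (s := s)
          rw [hφ.1 i, one_pow] at this
          simpa only [norm_inner_symm (φ i)] using this
      _ = n := by simp
  refine hasSum_le_of_sum_le hsum fun s => ?_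
  -- After subtraction of the threshold `x n`, terms with `k < n` grow when `w k` is replaced by
  -- `1`, and those with `k ≥ n` are nonpositive. The subtracted part is at most `n * x n` because
  -- `x n ≥ 0`.
  have h1 : ∑ k ∈ s, (x k - x n) * w k ≤ ∑ k ∈ Finset.range n, (x k - x n) := by
    calc ∑ k ∈ s, (x k - x n) * w k
        ≤ ∑ k ∈ s, (if k ∈ Finset.range n then x k - x n else 0) := by
          refine Finset.sum_le_sum fun k _ => ?_
          split_ifs with hk
          · have := hanti (Finset.mem_range.1 hk).le
            nlinarith [hw1 k]
          · have := hanti (not_lt.1 fun h => hk (Finset.mem_range.2 h))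
            nlinarith [hw0 k]
      _ = ∑ k ∈ s ∩ Finset.range n, (x k - x n) := Finset.sum_ite_mem _ _ _
      _ ≤ _ := Finset.sum_le_sum_of_subset_of_nonneg Finset.inter_subset_right fun k hk _ =>
          sub_nonneg.2 (hanti (Finset.mem_range.1 hk).le)
  have h2 : ∑ k ∈ s, x k * w k = ∑ k ∈ s, (x k - x n) * w k + x n * ∑ k ∈ s, w k := by
    rw [Finset.mul_sum, ← Finset.sum_add_distrib]
    exact Finset.sum_congr rfl fun k _ => by ring
  rw [Finset.sum_sub_distrib, Finset.sum_const, Finset.card_range, nsmul_eq_mul] at h1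
  nlinarith [mul_le_mul_of_nonneg_left (hwn s) (h0 n)]

theorem re_inner_eq_of_hasSum_rankOne {X : H →L[ℂ] H} {x : ℕ → ℝ} {ψ : ℕ → H}
    (hψ : Orthonormal ℂ ψ) (h : HasSum (fun k => (x k : ℂ) • rankOne ℂ (ψ k) (ψ k)) X) (i : ℕ) :
    (inner ℂ (ψ i) (X (ψ i))).re = x i := by
  refine (hasSum_re_inner_of_hasSum_rankOne h (ψ i)).unique ?_
  convert hasSum_single i fun k hk => ?_ using 1
  · simp [hψ.1 i]
  · simp [hψ.2 hk.symm]

/-- Ky Fan's bound is attained on the eigenvectors themselves, so the partial sums of either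
sequence dominate those of the other. This frees `eigenvalues` from its arbitrary choice. -/
theorem IsEigenvalueSequence.unique {X : H →L[ℂ] H} {x y : ℕ → ℝ}
    (hx : IsEigenvalueSequence X x) (hy : IsEigenvalueSequence X y) : x = y := by
  have key : ∀ {x y : ℕ → ℝ}, IsEigenvalueSequence X x → IsEigenvalueSequence X y → ∀ n,
      ∑ i ∈ Finset.range n, y i ≤ ∑ i ∈ Finset.range n, x i := by
    intro x y hx ⟨_, _, ψ, hψ, hs⟩ n
    simpa only [re_inner_eq_of_hasSum_rankOne hψ hs] using hx.sum_re_inner_le hψ n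
  have heq : ∀ n, ∑ i ∈ Finset.range n, x i = ∑ i ∈ Finset.range n, y i := fun n =>
    le_antisymm (key hy hx n) (key hx hy n)
  funext n
  have := heq (n + 1)
  rwa [Finset.sum_range_succ, Finset.sum_range_succ, heq n, add_right_inj] at this

theorem IsEigenvalueSequence.eigenvalues_eq {X : H →L[ℂ] H} {x : ℕ → ℝ}
    (hx : IsEigenvalueSequence X x) : eigenvalues X = x := by
  have h : ∃ x, IsEigenvalueSequence X x := ⟨x, hx⟩
  rw [show eigenvalues X = h.choose by simp only [eigenvalues, dif_pos h]]
  exact h.choose_spec.unique hx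

theorem antitone_eigenvalues (X : H →L[ℂ] H) : Antitone (eigenvalues X) := by
  by_cases h : ∃ x, IsEigenvalueSequence X x
  · rw [show eigenvalues X = h.choose by simp only [eigenvalues, dif_pos h]]
    exact h.choose_spec.1
  · rw [show eigenvalues X = 0 by simp only [eigenvalues, dif_neg h]]
    exact antitone_const

variable (b : HilbertBasis ℕ ℂ H)

theorem hasSum_diagonal {x : ℕ → ℝ} (hx : ∀ n, 0 ≤ x n) (hs : Summable x)
    [CompleteSpace H] :
    HasSum (fun n => (x n : ℂ) • rankOne ℂ (b n) (b n)) (diagonal b x) := by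
  refine Summable.hasSum (Summable.of_norm_bounded hs fun n => ?_)
  rw [norm_smul, norm_rankOne, b.orthonormal.1 n]
  simp [abs_of_nonneg (hx n)]

variable [CompleteSpace H]

theorem isEigenvalueSequence_diagonal {x : ℕ → ℝ} (hx : ∀ n, 0 ≤ x n) (ha : Antitone x)
    (hs : Summable x) : IsEigenvalueSequence (diagonal b x) x :=
  ⟨ha, hx, b, b.orthonormal, hasSum_diagonal b hx hs⟩

theorem summable_eigenvalues (X : traceClass b) : Summable (eigenvalues (X : H →L[ℂ] H)) := by
  have := ENNReal.summable_toReal (tsum_eigenvalues_lt_top b X).ne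
  simpa [ENNReal.toReal_ofReal (eigenvalues_nonneg _ _)] using this

theorem eigenvalues_fockRearrangement (X : traceClass b) :
    eigenvalues (fockRearrangement b X : H →L[ℂ] H) = eigenvalues (X : H →L[ℂ] H) :=
  (isEigenvalueSequence_diagonal b (eigenvalues_nonneg _) (antitone_eigenvalues _)
    (summable_eigenvalues b X)).eigenvalues_eq

theorem isPassive_fockRearrangement (X : traceClass b) : IsPassive b (fockRearrangement b X) := by
  refine Subtype.ext ?_
  change diagonal b _ = diagonal b (eigenvalues (fockRearrangement b X : H →L[ℂ] H))
  rw [eigenvalues_fockRearrangement]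

theorem hasSum_fockRearrangement (X : traceClass b) :
    HasSum (fun n => (eigenvalues (X : H →L[ℂ] H) n : ℂ) • rankOne ℂ (b n) (b n))
      (fockRearrangement b X : H →L[ℂ] H) :=
  hasSum_diagonal b (eigenvalues_nonneg _) (summable_eigenvalues b X)

theorem fockRearrangement_nonneg (X : traceClass b) :
    0 ≤ (fockRearrangement b X : H →L[ℂ] H) :=
  (hasSum_fockRearrangement b X).nonneg fun n =>
    smul_nonneg (by exact_mod_cast eigenvalues_nonneg _ n) (rankOne_self_nonneg _)

theorem IsPassive.re_inner_eq_eigenvalues {X : traceClass b} (hX : IsPassive b X) (i : ℕ) :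
    (inner ℂ (b i) ((X : H →L[ℂ] H) (b i))).re = eigenvalues (X : H →L[ℂ] H) i := by
  have h := hasSum_fockRearrangement b X
  rw [← show X = fockRearrangement b X from hX] at h
  exact re_inner_eq_of_hasSum_rankOne b.orthonormal h i

theorem sum_re_inner_le_sum_eigenvalues {X : traceClass b} (hX : 0 ≤ (X : H →L[ℂ] H)) (n : ℕ) :
    ∑ i ∈ Finset.range n, (inner ℂ (b i) ((X : H →L[ℂ] H) (b i))).re ≤
      ∑ i ∈ Finset.range n, eigenvalues (X : H →L[ℂ] H) i := by
  obtain ⟨x, hx⟩ := exists_isEigenvalueSequence b hX X.2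
  rw [hx.eigenvalues_eq]
  exact hx.sum_re_inner_le b.orthonormal n

end KyFan

/-! ### Action of quantum operations on Fock states, and monotonicity -/

section Maps

open InnerProductSpace Filter Topology

variable {H : Type*} [NormedAddCommGroup H] [InnerProductSpace ℂ H] {b : HilbertBasis ℕ ℂ H}

/-- The sum of the first `n` diagonal entries, as a functional on operators. -/
noncomputable def diagonalSum (b : HilbertBasis ℕ ℂ H) (n : ℕ) : (H →L[ℂ] H) →ₗ[ℝ] ℝ where
  toFun X := ∑ i ∈ Finset.range n, (inner ℂ (b i) (X (b i))).re
  map_add' X Y := by simp [Finset.sum_add_distrib]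
  map_smul' c X := by
    rw [Finset.smul_sum]
    refine Finset.sum_congr rfl fun i _ => ?_
    rw [RCLike.real_smul_eq_coe_smul (K := ℂ) c X]
    simp

theorem diagonalSum_apply (n : ℕ) (X : H →L[ℂ] H) :
    diagonalSum b n X = ∑ i ∈ Finset.range n, (inner ℂ (b i) (X (b i))).re := rfl

theorem diagonalSum_nonneg {X : H →L[ℂ] H} (hX : 0 ≤ X) (n : ℕ) : 0 ≤ diagonalSum b n X :=
  Finset.sum_nonneg (s := Finset.range n) fun i _ =>
    ((ContinuousLinearMap.nonneg_iff_isPositive _).1 hX).re_inner_nonneg_right (b i)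

theorem isEigenvalueSequence_sum_rankOne {ψ : ℕ → H} (hψ : Orthonormal ℂ ψ) (m : ℕ) :
    IsEigenvalueSequence (∑ i ∈ Finset.range m, rankOne ℂ (ψ i) (ψ i))
      fun i => if i < m then 1 else 0 := by
  refine ⟨fun i j hij => ?_, fun n => by dsimp only; split_ifs <;> simp, ψ, hψ, ?_⟩
  · dsimp only
    split_ifs with h1 h2
    · exact le_rfl
    · exact absurd (hij.trans_lt h1) h2
    · exact zero_le_one
    · exact le_rfl
  · rw [Finset.sum_congr rfl fun i hi => show rankOne ℂ (ψ i) (ψ i) =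
      ((if i < m then 1 else 0 : ℝ) : ℂ) • rankOne ℂ (ψ i) (ψ i) by simp [Finset.mem_range.1 hi]]
    refine hasSum_sum_of_ne_finset_zero fun k hk => ?_
    dsimp only
    rw [if_neg fun h => hk (Finset.mem_range.2 h), Complex.ofReal_zero, zero_smul]

variable [CompleteSpace H] {Φ : traceClass b →ₗ[ℂ] traceClass b}

/-- This is the `1 × 1` case of complete positivity. The order on `ℂ` makes the quadratic form real,
which gives symmetry. -/
theorem CompletelyPositive.nonneg (hΦ : CompletelyPositive b Φ) {X : traceClass b}
    (hX : 0 ≤ (X : H →L[ℂ] H)) : 0 ≤ (Φ X : H →L[ℂ] H) := by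
  have h := hΦ 1 (fun _ _ => X) fun v => by
    simpa using ((ContinuousLinearMap.nonneg_iff_isPositive _).1 hX).inner_nonneg_right (v 0)
  rw [ContinuousLinearMap.nonneg_iff_isPositive, ContinuousLinearMap.isPositive_iff_complex]
  intro v
  have hv : 0 ≤ inner ℂ v ((Φ X : H →L[ℂ] H) v) := by simpa using h fun _ => v
  have hsa := Complex.conj_eq_iff_re.1 hv.isSelfAdjoint.star_eq
  rw [← inner_conj_symm, ← hsa]
  simpa using (Complex.nonneg_iff.1 hv).1

theorem IsQuantumOperation.comp {Ψ : traceClass b →ₗ[ℂ] traceClass b}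
    (hΨ : IsQuantumOperation b Ψ) (hΦ : IsQuantumOperation b Φ) :
    IsQuantumOperation b (Ψ ∘ₗ Φ) where
  completelyPositive n X hX :=
    hΨ.completelyPositive n (fun i j => Φ (X i j)) (hΦ.completelyPositive n X hX)
  traceNormContinuous X ε hε := by
    obtain ⟨δ, hδ, h⟩ := hΨ.traceNormContinuous (Φ X) ε hε
    obtain ⟨η, hη, h'⟩ := hΦ.traceNormContinuous X δ hδ
    exact ⟨η, hη, fun Y hY => h (Φ Y) (h' Y hY)⟩

theorem IsPassive.diagonalSum_eq {X : traceClass b} (hX : IsPassive b X) (n : ℕ) :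
    diagonalSum b n (X : H →L[ℂ] H) =
      ∑ i ∈ Finset.range n, eigenvalues (X : H →L[ℂ] H) i :=
  Finset.sum_congr (s₁ := Finset.range n) rfl fun i _ => hX.re_inner_eq_eigenvalues b i

/-- The bound lets diagonal sums pass to trace-norm limits. -/
theorem ofReal_abs_diagonalSum_le (n : ℕ) (X : H →L[ℂ] H) :
    ENNReal.ofReal |diagonalSum b n X| ≤ traceNorm b X := by
  refine le_trans (ENNReal.ofReal_le_ofReal ?_)
    (sum_norm_le_traceNorm b X 1 ContinuousLinearMap.norm_id_le n)
  rw [diagonalSum_apply]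
  refine (Finset.abs_sum_le_sum_abs _ _).trans (Finset.sum_le_sum fun i _ => ?_)
  exact Complex.abs_re_le_norm _

theorem traceNorm_sub_comm (X Y : H →L[ℂ] H) : traceNorm b (X - Y) = traceNorm b (Y - X) := by
  have := traceNorm_smul b (-1) (Y - X)
  simpa using this

theorem TraceNormContinuous.tendsto_diagonalSum (hΦ : TraceNormContinuous b
      fun X => (Φ X : H →L[ℂ] H)) {X : ℕ → traceClass b} {Y : traceClass b}
    (h : Tendsto (fun N => traceNorm b ((X N : H →L[ℂ] H) - Y)) atTop (𝓝 0)) (n : ℕ) :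
    Tendsto (fun N => diagonalSum b n (Φ (X N) : H →L[ℂ] H)) atTop
      (𝓝 (diagonalSum b n (Φ Y : H →L[ℂ] H))) := by
  rw [Metric.tendsto_nhds]
  intro ε hε
  obtain ⟨δ, hδ, hc⟩ := hΦ Y (ENNReal.ofReal ε) (ENNReal.ofReal_pos.2 hε)
  filter_upwards [h.eventually (gt_mem_nhds hδ)] with N hN
  have h1 := (ofReal_abs_diagonalSum_le n _).trans_lt (hc (X N) hN)
  rw [Real.dist_eq, ← map_sub]
  exact (ENNReal.ofReal_lt_ofReal_iff hε).1 h1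

theorem rankOne_mem_traceClass {u : H} (hu : ‖u‖ = 1) : rankOne ℂ u u ∈ traceClass b := by
  -- The coefficients are `1, 0, 0, …`; a constant family of vectors suffices because
  -- `traceNorm_of_hasSum` asks for unit vectors only, not orthogonal ones.
  have h : HasSum (fun k => ((if k = 0 then 1 else 0 : ℝ) : ℂ) • rankOne ℂ u u)
      (rankOne ℂ u u) := by
    convert hasSum_single 0 fun k hk => ?_ using 1
    · simp
    · simp [hk]
  change traceNorm b _ < ∞
  rw [traceNorm_of_hasSum b (ψ := fun _ => u) (fun n => by split_ifs <;> simp) (fun _ => hu) h,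
    tsum_eq_single 0 fun k hk => by simp [hk]]
  simp

/-- The projector `|n⟩⟨n|` onto a Fock state. -/
noncomputable def fockProjector (b : HilbertBasis ℕ ℂ H) (n : ℕ) : traceClass b :=
  ⟨rankOne ℂ (b n) (b n), rankOne_mem_traceClass (b.orthonormal.1 n)⟩

/-- The permuted basis is still orthonormal, so the eigenvalues are `m` ones followed by zeros,
whatever `σ` is. -/
theorem fockRearrangement_sum_fockProjector (σ : Equiv.Perm ℕ) (m : ℕ) :
    fockRearrangement b (∑ i ∈ Finset.range m, fockProjector b (σ i)) =
      ∑ i ∈ Finset.range m, fockProjector b i := by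
  have h1 : ((∑ i ∈ Finset.range m, fockProjector b (σ i) : traceClass b) : H →L[ℂ] H) =
      ∑ i ∈ Finset.range m, rankOne ℂ (b (σ i)) (b (σ i)) := by
    simp [fockProjector]
  have h2 := (isEigenvalueSequence_sum_rankOne
    (b.orthonormal.comp σ σ.injective) m).eigenvalues_eq
  refine Subtype.ext ?_
  change diagonal b (eigenvalues ((∑ i ∈ Finset.range m, fockProjector b (σ i) : traceClass b) :
    H →L[ℂ] H)) = _
  rw [h1]
  simp only [Function.comp_apply] at h2
  rw [h2, diagonal, tsum_eq_sum (s := Finset.range m)]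
  · simp only [AddSubmonoidClass.coe_finsetSum, fockProjector]
    exact Finset.sum_congr rfl fun i hi => by simp [Finset.mem_range.1 hi]
  · intro k hk
    rw [if_neg fun h => hk (Finset.mem_range.2 h), Complex.ofReal_zero, zero_smul]

theorem sum_fockProjector_nonneg (s : Finset ℕ) (σ : ℕ → ℕ) :
    0 ≤ ((∑ i ∈ s, fockProjector b (σ i) : traceClass b) : H →L[ℂ] H) := by
  simp only [AddSubmonoidClass.coe_finsetSum]
  exact Finset.sum_nonneg fun i _ => rankOne_self_nonneg _

/-- The dual of a passive-preserving Fock-optimal operation maps the projector onto the first Fock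
states to an operator with decreasing diagonal. -/
theorem antitone_diagonalSum_fockProjector (hΦ : IsQuantumOperation b Φ)
    (hp : PassivePreserving b Φ) (ho : FockOptimal b Φ) (n : ℕ) :
    Antitone fun k => diagonalSum b (n + 1) (Φ (fockProjector b k) : H →L[ℂ] H) := by
  refine antitone_nat_of_succ_le fun j => ?_
  -- With this transposition, `X` is the sum of the projectors for `0, …, j - 1` and `j + 1`, while
  -- its rearrangement has `j` in place of `j + 1`.
  set σ : Equiv.Perm ℕ := Equiv.swap j (j + 1)
  set X : traceClass b := ∑ i ∈ Finset.range (j + 1), fockProjector b (σ i) with hX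
  have hXpos : 0 ≤ (X : H →L[ℂ] H) := sum_fockProjector_nonneg _ _
  have h1 := sum_re_inner_le_sum_eigenvalues b (hΦ.completelyPositive.nonneg hXpos) (n + 1)
  have h2 := ho X ((ContinuousLinearMap.nonneg_iff_isPositive _).1 hXpos) n
  have h3 := (hp _ ((ContinuousLinearMap.nonneg_iff_isPositive _).1
    (fockRearrangement_nonneg b X)) (isPassive_fockRearrangement b X)).diagonalSum_eq (n + 1)
  have h4 := (h1.trans h2).trans h3.ge
  rw [← diagonalSum_apply, hX, fockRearrangement_sum_fockProjector] at h4
  have h5 : ∑ i ∈ Finset.range j, fockProjector b (σ i) =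
      ∑ i ∈ Finset.range j, fockProjector b i := by
    refine Finset.sum_congr rfl fun i hi => ?_
    have := Finset.mem_range.1 hi
    rw [Equiv.swap_apply_of_ne_of_ne (by omega) (by omega)]
  -- The first `j` projectors agree on both sides and cancel by linearity.
  rw [Finset.sum_range_succ, Finset.sum_range_succ, h5, Equiv.swap_apply_left] at h4
  simpa using h4

theorem tendsto_traceNorm_sum_fockProjector_sub (X : traceClass b) :
    Tendsto (fun N => traceNorm b (((∑ k ∈ Finset.range N,
      (eigenvalues (X : H →L[ℂ] H) k : ℂ) • fockProjector b k : traceClass b) : H →L[ℂ] H) -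
        fockRearrangement b X)) atTop (𝓝 0) := by
  refine (ENNReal.tendsto_sum_nat_add _ (tsum_eigenvalues_lt_top b X).ne).congr fun N => ?_
  -- With the sign reversed the difference is the positive tail of the diagonal series, whose trace
  -- norm is the tail sum of the eigenvalues.
  rw [traceNorm_sub_comm]
  have h := (hasSum_nat_add_iff' N).2 (hasSum_fockRearrangement b X)
  rw [← traceNorm_of_hasSum b (fun n => eigenvalues_nonneg _ (n + N))
    (fun n => b.orthonormal.1 (n + N)) h]
  simp [fockProjector]

/-- Continuity moves `Φ` inside the series for `X↓`. The factors multiplying the eigenvalues depend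
on `Φ` and `n` alone, so different `X` can be compared term by term. -/
theorem tendsto_sum_mul_diagonalSum (hΦ : IsQuantumOperation b Φ) (X : traceClass b) (n : ℕ) :
    Tendsto (fun N => ∑ k ∈ Finset.range N, eigenvalues (X : H →L[ℂ] H) k *
        diagonalSum b n (Φ (fockProjector b k) : H →L[ℂ] H)) atTop
      (𝓝 (diagonalSum b n (Φ (fockRearrangement b X) : H →L[ℂ] H))) := by
  refine (hΦ.traceNormContinuous.tendsto_diagonalSum
    (tendsto_traceNorm_sum_fockProjector_sub X) n).congr fun N => ?_
  simp only [map_sum, map_smul, AddSubmonoidClass.coe_finsetSum, Submodule.coe_smul]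
  refine Finset.sum_congr rfl fun k _ => ?_
  exact (diagonalSum b n).map_smul _ _

/-- Summation by parts. -/
theorem sum_mul_le_sum_mul_of_antitone {x y c : ℕ → ℝ} (hc : Antitone c) (hc0 : ∀ n, 0 ≤ c n)
    (h : ∀ n, ∑ i ∈ Finset.range (n + 1), x i ≤ ∑ i ∈ Finset.range (n + 1), y i) (N : ℕ) :
    ∑ i ∈ Finset.range N, x i * c i ≤ ∑ i ∈ Finset.range N, y i * c i := by
  -- Induction needs this stronger form, which keeps the boundary term of the summation by parts:
  -- the current gap of partial sums times the last weight.
  have key : ∀ N, (∑ i ∈ Finset.range (N + 1), y i - ∑ i ∈ Finset.range (N + 1), x i) * c N ≤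
      ∑ i ∈ Finset.range (N + 1), y i * c i - ∑ i ∈ Finset.range (N + 1), x i * c i := by
    intro N
    induction N with
    | zero => simp [sub_mul]
    | succ N ih =>
      have h1 := mul_le_mul_of_nonneg_left (hc N.le_succ) (sub_nonneg.2 (h N))
      rw [Finset.sum_range_succ _ (N + 1), Finset.sum_range_succ _ (N + 1),
        Finset.sum_range_succ _ (N + 1), Finset.sum_range_succ _ (N + 1)]
      rw [Nat.succ_eq_add_one] at h1
      linarith
  cases N with
  | zero => simp
  | succ N => exact sub_nonneg.1 ((mul_nonneg (sub_nonneg.2 (h N)) (hc0 N)).trans (key N))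

/-- A passive-preserving Fock-optimal operation is monotone for weak sub-majorization on Fock
rearrangements. -/
theorem WeaklySubmajorizedBy.map_fockRearrangement (hΦ : IsQuantumOperation b Φ)
    (hp : PassivePreserving b Φ) (ho : FockOptimal b Φ) {X Y : traceClass b}
    (h : WeaklySubmajorizedBy b X Y) :
    WeaklySubmajorizedBy b (Φ (fockRearrangement b X)) (Φ (fockRearrangement b Y)) := by
  intro n
  have hpass : ∀ Z : traceClass b, IsPassive b (Φ (fockRearrangement b Z)) := fun Z =>
    hp _ ((ContinuousLinearMap.nonneg_iff_isPositive _).1 (fockRearrangement_nonneg b Z))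
      (isPassive_fockRearrangement b Z)
  -- Passivity turns eigenvalue sums into diagonal sums, which are linear in the operator and limits
  -- of weighted eigenvalue sums.
  rw [← (hpass X).diagonalSum_eq, ← (hpass Y).diagonalSum_eq]
  refine le_of_tendsto_of_tendsto' (tendsto_sum_mul_diagonalSum hΦ X (n + 1))
    (tendsto_sum_mul_diagonalSum hΦ Y (n + 1)) fun N => ?_
  refine sum_mul_le_sum_mul_of_antitone (antitone_diagonalSum_fockProjector hΦ hp ho n)
    (fun k => diagonalSum_nonneg (hΦ.completelyPositive.nonneg ?_) _) h N
  exact rankOne_self_nonneg _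

end Maps

end FockOptimality

open FockOptimality
theorem mainTheorem3 {H : Type*} [NormedAddCommGroup H] [InnerProductSpace ℂ H] [CompleteSpace H]
    (b : HilbertBasis ℕ ℂ H) (Φ₁ Φ₂ : traceClass b →ₗ[ℂ] traceClass b)
    (hΦ₁ : IsQuantumOperation b Φ₁) (hΦ₂ : IsQuantumOperation b Φ₂)
    (hp₁ : PassivePreserving b Φ₁) (hp₂ : PassivePreserving b Φ₂)
    (ho₁ : FockOptimal b Φ₁) (ho₂ : FockOptimal b Φ₂)
    (hdual : TraceNormContinuous b
      fun Y : traceClass b => hilbertSchmidtDual b Φ₂ (Y : H →L[ℂ] H)) :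
    IsQuantumOperation b (Φ₂ ∘ₗ Φ₁) ∧ PassivePreserving b (Φ₂ ∘ₗ Φ₁) ∧ FockOptimal b (Φ₂ ∘ₗ Φ₁) := by
  have hpos : ∀ X : traceClass b, (X : H →L[ℂ] H).IsPositive →
      (Φ₁ X : H →L[ℂ] H).IsPositive := fun X hX =>
    (ContinuousLinearMap.nonneg_iff_isPositive _).1 (hΦ₁.completelyPositive.nonneg
      ((ContinuousLinearMap.nonneg_iff_isPositive _).2 hX))
  refine ⟨hΦ₂.comp hΦ₁, fun X hX hXp => hp₂ _ (hpos X hX) (hp₁ X hX hXp), fun X hX n => ?_⟩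
  refine (ho₂ _ (hpos X hX) n).trans ?_
  have hpass : IsPassive b (Φ₁ (fockRearrangement b X)) :=
    hp₁ _ ((ContinuousLinearMap.nonneg_iff_isPositive _).1 (fockRearrangement_nonneg b X))
      (isPassive_fockRearrangement b X)
  -- Monotonicity of `Φ₂` is applied to `Φ₁(X) ≺_w Φ₁(X↓)`; passivity then removes the rearrangement
  -- around `Φ₁(X↓)`.
  have h := WeaklySubmajorizedBy.map_fockRearrangement hΦ₂ hp₂ ho₂ (ho₁ X hX) n
  rwa [← show Φ₁ (fockRearrangement b X) = fockRearrangement b (Φ₁ (fockRearrangement b X)) from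
    hpass] at h
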